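/- Let $p\ge 2$ and $n_1,\dots,n_p\ge 2$, and let $V=\mathbb{C}^{n_1}\otimes\cdots\otimes\mathbb{C}^{n_p}$. Fix inner products $\langle\cdot,\cdot\rangle_i$ on $\mathbb{R}^{n_i}$, extended to complex-bilinear forms on $\mathbb{C}^{n_i}$, and let $\langle\cdot,\cdot\rangle_{BW}$ be the Bombieri--Weyl bilinear form on $V$, determined by $\langle x_1\otimes\cdots\otimes x_p,\,y_1\otimes\cdots\otimes y_p\rangle_{BW}=\prod_{i=1}^p\langle x_i,y_i\rangle_i$. Write $x\perp y$ when the relevant bilinear form vanishes on $(x,y)$. Let $X\subseteq V$ be the variety of tensors $x_1\otimes\cdots\otimes x_p$ of rank at most one, and for a regular point $x\in X_{reg}$ let $N_xX$ be the orthogonal complement of the tangent space $T_xX$ with respect to $\langle\cdot,\cdot\rangle_{BW}$. A critical rank-one approximation of $T\in V$ is a point $x\in X_{reg}$ with $T-x\in N_xX$. Let $$\operatorname{DL}_2=\overline{\{T\in V\mid \text{there is a critical rank-one approximation } x \text{ of } T \text{ with } T-x\in X\}}$$ (Zariski closure). A tensor is weakly orthogonally decomposable if it can be written as $\sum_{k=1}^m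 x^k_1\otimes\cdots\otimes x^k_p$ with all $x^k_j$ nonzero and $x^k_j\perp x^l_j$ for all $k\ne l$ and all $1\le j\le p$. Then $\operatorname{DL}_2$ has exactly $\binom p2$ irreducible components. They are the sets $$C_{ij}=\overline{\{x_1\otimes\cdots\otimes x_p+y_1\otimes\cdots\otimes y_p\mid x_k,y_k\in\mathbb{C}^{n_k}\ (1\le k\le p),\ x_i\perp y_i,\ x_j\perp y_j\}},\qquad 1\le i<j\le p$$ (Zariski closures), and different pairs $(i,j)$ give different components. Moreover, every weakly orthogonally decomposable tensor of rank at most two lies in the intersection of all these components. -/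

import Mathlib

open scoped TensorProduct

noncomputable section

namespace TensorDL

section Zariski

variable (V : Type*) [AddCommGroup V] [Module ℂ V]

/-- Polynomial functions on a complex vector space: the algebra of functions generated by the
linear functionals. -/
def polyFun : Subalgebra ℂ (V → ℂ) :=
  Algebra.adjoin ℂ (Set.range fun φ : Module.Dual ℂ V => (φ : V → ℂ))

/-- The Zariski topology: the sets `f ≠ 0`, for polynomial functions `f`, form a base of it. -/
@[reducible] def zariskiTopology : TopologicalSpace V :=
  TopologicalSpace.generateFrom {U | ∃ f ∈ polyFun V, U = {v | f v ≠ 0}}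

variable {V}

/-- Closure in the Zariski topology. -/
def zariskiClosure (S : Set V) : Set V :=
  @closure V (zariskiTopology V) S

/-- The irreducible components of a subset `Z` of `V` (with the topology induced by the Zariski
topology of `V`), as subsets of `V`. -/
def zariskiComponents (Z : Set V) : Set (Set V) :=
  letI : TopologicalSpace V := zariskiTopology V
  (fun C : Set Z => (Subtype.val '' C : Set V)) '' irreducibleComponents Z

/-- The differential of a polynomial function at a point: all directional derivatives exist and
depend linearly on the direction. -/
theorem polyFun_hasLineDerivAt {f : V → ℂ} (hf : f ∈ polyFun V) (x : V) :
    ∃ L : V →ₗ[ℂ] ℂ, ∀ v, HasLineDerivAt ℂ f (L v) x v := by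
  induction hf using Algebra.adjoin_induction with
  | mem f hf =>
    obtain ⟨φ, rfl⟩ := hf
    refine ⟨φ, fun v => ?_⟩
    have h : HasDerivAt (fun t : ℂ => φ x + t * φ v) (φ v) 0 := by
      simpa using ((hasDerivAt_id (0 : ℂ)).mul_const (φ v)).const_add (φ x)
    simpa [HasLineDerivAt] using h
  | algebraMap r =>
    refine ⟨0, fun v => ?_⟩
    simpa [HasLineDerivAt] using hasDerivAt_const (0 : ℂ) r
  | add f g _ _ hf hg =>
    obtain ⟨L, hL⟩ := hf
    obtain ⟨M, hM⟩ := hg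
    exact ⟨L + M, fun v => HasDerivAt.add (hL v) (hM v)⟩
  | mul f g _ _ hf hg =>
    obtain ⟨L, hL⟩ := hf
    obtain ⟨M, hM⟩ := hg
    refine ⟨g x • L + f x • M, fun v => ?_⟩
    have h := HasDerivAt.mul (hL v) (hM v)
    simp only [zero_smul, add_zero] at h
    have e : L v * g x + f x * M v = (g x • L + f x • M) v := by
      simp [mul_comm]
    rw [e] at h
    exact h

/-- The (Zariski) tangent space of `X` at `x`: the vectors `v` such that `df_x(v) = 0` for all
polynomial functions `f` vanishing on `X`. -/
def tangentSpace (X : Set V) (x : V) : Submodule ℂ V where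
  carrier := {v | ∀ f ∈ polyFun V, (∀ z ∈ X, f z = 0) → lineDeriv ℂ f x v = 0}
  zero_mem' := by
    intro f _ _
    exact lineDeriv_zero
  add_mem' := by
    intro v w hv hw f hf hX
    obtain ⟨L, hL⟩ := polyFun_hasLineDerivAt hf x
    have h1 := hv f hf hX
    have h2 := hw f hf hX
    rw [(hL _).lineDeriv] at h1 h2 ⊢
    rw [map_add, h1, h2, add_zero]
  smul_mem' := by
    intro c v hv f hf hX
    obtain ⟨L, hL⟩ := polyFun_hasLineDerivAt hf x
    have h1 := hv f hf hX
    rw [(hL _).lineDeriv] at h1 ⊢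
    rw [map_smul, h1, smul_zero]

/-- The regular points of an irreducible variety `X` in a finite-dimensional space: the points
where the dimension of the tangent space attains its minimum over `X` (this minimum is the
dimension of `X`). -/
def regularLocus (X : Set V) : Set V :=
  {x | x ∈ X ∧ ∀ z ∈ X,
    Module.finrank ℂ (tangentSpace X x) ≤ Module.finrank ℂ (tangentSpace X z)}

/-- The normal space of `X` at `x` with respect to a bilinear form. -/
def normalSpace (b : LinearMap.BilinForm ℂ V) (X : Set V) (x : V) : Submodule ℂ V :=
  (tangentSpace X x).orthogonalBilin b

end Zariski

section Tensors

variable {p : ℕ} {n : Fin p → ℕ}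

/-- `ℂ^{n_1} ⊗ ⋯ ⊗ ℂ^{n_p}`. -/
abbrev TensorSpace {p : ℕ} (n : Fin p → ℕ) : Type := ⨂[ℂ] i, (Fin (n i) → ℂ)

/-- A real bilinear form is an inner product: symmetric and positive definite. -/
def IsInnerProduct {m : ℕ} (b : LinearMap.BilinForm ℝ (Fin m → ℝ)) : Prop :=
  (∀ x y, b x y = b y x) ∧ ∀ x, x ≠ 0 → 0 < b x x

/-- The complex-bilinear extension to `ℂ^m` of a real bilinear form on `ℝ^m`
(the form with the same Gram matrix in the standard basis). -/
def complexify {m : ℕ} (b : LinearMap.BilinForm ℝ (Fin m → ℝ)) :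
    LinearMap.BilinForm ℂ (Fin m → ℂ) :=
  Matrix.toBilin' ((LinearMap.BilinForm.toMatrix' b).map (fun r : ℝ => (r : ℂ)))

/-- The Bombieri–Weyl bilinear form: the bilinear form on the tensor space whose value on
`x_1 ⊗ ⋯ ⊗ x_p`, `y_1 ⊗ ⋯ ⊗ y_p` is `∏ i, ⟨x_i, y_i⟩_i`. -/
def bombieriWeyl (B : ∀ i, LinearMap.BilinForm ℝ (Fin (n i) → ℝ)) :
    LinearMap.BilinForm ℂ (TensorSpace n) :=
  PiTensorProduct.dualDistrib ∘ₗ PiTensorProduct.map (fun i => complexify (B i))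

theorem bombieriWeyl_tprod (B : ∀ i, LinearMap.BilinForm ℝ (Fin (n i) → ℝ))
    (x y : ∀ i, Fin (n i) → ℂ) :
    bombieriWeyl B (⨂ₜ[ℂ] i, x i) (⨂ₜ[ℂ] i, y i) = ∏ i, complexify (B i) (x i) (y i) := by
  simp [bombieriWeyl, PiTensorProduct.map_tprod, PiTensorProduct.dualDistrib_apply]

/-- The variety of tensors `x_1 ⊗ ⋯ ⊗ x_p` of rank at most one. -/
def rankOne (n : Fin p → ℕ) : Set (TensorSpace n) :=
  {T | ∃ x : ∀ i, Fin (n i) → ℂ, T = ⨂ₜ[ℂ] i, x i}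

/-- `T` has rank at most `r`. -/
def RankLE (r : ℕ) (T : TensorSpace n) : Prop :=
  ∃ u : Fin r → TensorSpace n, (∀ k, u k ∈ rankOne n) ∧ T = ∑ k, u k

/-- `x` is a critical rank-one approximation of `T`: a regular point of the variety of rank-one
tensors at which `T - x` is normal to that variety. -/
def IsCriticalRankOneApprox (B : ∀ i, LinearMap.BilinForm ℝ (Fin (n i) → ℝ))
    (T x : TensorSpace n) : Prop :=
  x ∈ regularLocus (rankOne n) ∧ T - x ∈ normalSpace (bombieriWeyl B) (rankOne n) x

/-- The data locus `DL₂`: the Zariski closure of the set of tensors from which one can subtract a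
critical rank-one approximation so that the result has rank at most one. -/
def DL2 (B : ∀ i, LinearMap.BilinForm ℝ (Fin (n i) → ℝ)) : Set (TensorSpace n) :=
  zariskiClosure {T | ∃ x, IsCriticalRankOneApprox B T x ∧ T - x ∈ rankOne n}

/-- `T` is weakly orthogonally decomposable: a sum of rank-one tensors whose vectors in each
factor are pairwise orthogonal (isotropic vectors are allowed). -/
def IsWeaklyOdeco (B : ∀ i, LinearMap.BilinForm ℝ (Fin (n i) → ℝ)) (T : TensorSpace n) : Prop :=
  ∃ (m : ℕ) (x : Fin m → ∀ j, Fin (n j) → ℂ),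
    (∀ k j, x k j ≠ 0) ∧
    (∀ k l, k ≠ l → ∀ j, complexify (B j) (x k j) (x l j) = 0) ∧
    T = ∑ k, ⨂ₜ[ℂ] j, x k j

/-- The Zariski closure of the set of sums of two tensors of rank at most one whose `i`-th vectors
are orthogonal and whose `j`-th vectors are orthogonal. -/
def pairLocus (B : ∀ i, LinearMap.BilinForm ℝ (Fin (n i) → ℝ)) (i j : Fin p) :
    Set (TensorSpace n) :=
  zariskiClosure {T | ∃ x y : ∀ k, Fin (n k) → ℂ,
    complexify (B i) (x i) (y i) = 0 ∧ complexify (B j) (x j) (y j) = 0 ∧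
    T = (⨂ₜ[ℂ] k, x k) + ⨂ₜ[ℂ] k, y k}

end Tensors

end TensorDL

end

open scoped TensorProduct

noncomputable section

namespace TensorDL

/-! ### Zariski closure, polynomial curves and irreducibility. -/

section Zariski

variable {V : Type*} [AddCommGroup V] [Module ℂ V]

/-! The tangent vectors at `⊗ x_k` that matter are those with one factor replaced by an arbitrary
vector. A rank-one tensor `⊗ y_k` is orthogonal to all of them exactly when the product of the
numbers `⟨x_i, y_i⟩` still vanishes after any one of them is omitted (all `y_k` being nonzero), that
is, when at least two of these numbers vanish. Hence the data locus is the finite union of the pair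
loci (`DL2_eq_iUnion`).

Each pair locus is irreducible: orthogonality in two factors can be parametrized polynomially by a
vector space (`mem_pairSet_iff`), so any two points of the defining set are joined by a polynomial
curve inside it.

The pair loci are incomparable because of a quadratic polynomial, `contractedMinor`: contract two
copies of a tensor by the form of the factor `s` and take a 2 × 2 minor in two other factors `a`,
`b`. On `⊗ u_k + ⊗ v_k` it equals `⟨u_s, v_s⟩` times minors of `(u_a, v_a)` and `(u_b, v_b)` and
further evaluations (`contractedMinor_add`). It therefore vanishes on every pair locus involving
`s`, but not on one that avoids `s`.

The same polynomial vanishes on sums of any length that are orthogonal in the factor `s`, so it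
controls weakly orthogonally decomposable tensors. If such a tensor is `⊗ u_k + ⊗ v_k` with three
independent factors, then `u_k ⊥ v_k` for all `k`. With exactly two independent factors, the vectors
in the others are isotropic, and the remaining rank-two matrix is a limit of matrices with an
orthogonal decomposition (`add_mem_zariskiClosure_orthogonal`). Otherwise the tensor has rank at
most one. -/

theorem dual_mem_polyFun (φ : Module.Dual ℂ V) : (φ : V → ℂ) ∈ polyFun V :=
  Algebra.subset_adjoin ⟨φ, rfl⟩

theorem isTopologicalBasis_zariski :
    @TopologicalSpace.IsTopologicalBasis V (zariskiTopology V)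
      {U | ∃ f ∈ polyFun V, U = {v | f v ≠ 0}} := by
  let := zariskiTopology V
  refine ⟨?_, ?_, rfl⟩
  · rintro _ ⟨f, hf, rfl⟩ _ ⟨g, hg, rfl⟩ x hx
    refine ⟨{v | (f * g) v ≠ 0}, ⟨_, mul_mem hf hg, rfl⟩, mul_ne_zero hx.1 hx.2, fun y hy => ?_⟩
    exact ⟨left_ne_zero_of_mul hy, right_ne_zero_of_mul hy⟩
  · refine Set.eq_univ_of_forall fun x => Set.mem_sUnion.2 ⟨_, ⟨1, one_mem _, rfl⟩, ?_⟩
    simp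

theorem mem_zariskiClosure_iff {S : Set V} {T : V} :
    T ∈ zariskiClosure S ↔ ∀ f ∈ polyFun V, (∀ s ∈ S, f s = 0) → f T = 0 := by
  let := zariskiTopology V
  rw [zariskiClosure, isTopologicalBasis_zariski.mem_closure_iff]
  constructor
  · intro h f hf hS
    by_contra hT
    obtain ⟨s, hs, hsS⟩ := h _ ⟨f, hf, rfl⟩ hT
    exact hs (hS s hsS)
  · rintro h _ ⟨f, hf, rfl⟩ hT
    by_contra hne
    refine hT (h f hf fun s hs => ?_)
    by_contra hfs
    exact hne ⟨s, hfs, hs⟩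

theorem subset_zariskiClosure (S : Set V) : S ⊆ zariskiClosure S :=
  let := zariskiTopology V
  subset_closure

theorem zariskiClosure_mono {S S' : Set V} (h : S ⊆ S') : zariskiClosure S ⊆ zariskiClosure S' :=
  let := zariskiTopology V
  closure_mono h

theorem isClosed_zariskiClosure (S : Set V) : @IsClosed V (zariskiTopology V) (zariskiClosure S) :=
  let := zariskiTopology V
  isClosed_closure

theorem zariskiClosure_subset {S S' : Set V} (h : S ⊆ zariskiClosure S') :
    zariskiClosure S ⊆ zariskiClosure S' :=
  let := zariskiTopology V
  closure_minimal h isClosed_closure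

/-- The algebra of polynomial functions of one variable. -/
def polyLine : Subalgebra ℂ (ℂ → ℂ) :=
  (Polynomial.aeval (R := ℂ) (id : ℂ → ℂ)).range

theorem mem_polyLine_iff {g : ℂ → ℂ} :
    g ∈ polyLine ↔ ∃ P : Polynomial ℂ, ∀ t, g t = P.eval t := by
  have key (P : Polynomial ℂ) (t : ℂ) :
      Polynomial.aeval (R := ℂ) (id : ℂ → ℂ) P t = P.eval t := by
    simp
  constructor
  · rintro ⟨P, rfl⟩
    exact ⟨P, key P⟩
  · rintro ⟨P, hP⟩
    exact ⟨P, funext fun t => (key P t).trans (hP t).symm⟩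

theorem id_mem_polyLine : (fun t : ℂ => t) ∈ polyLine :=
  mem_polyLine_iff.2 ⟨Polynomial.X, by simp⟩

theorem const_mem_polyLine (c : ℂ) : (fun _ : ℂ => c) ∈ polyLine :=
  mem_polyLine_iff.2 ⟨Polynomial.C c, by simp⟩

/-- Polynomials in one variable over `ℂ` form an integral domain. All density and irreducibility
arguments below reduce to this along curves. -/
theorem eq_zero_of_mul_eq_zero_of_mem_polyLine {g h : ℂ → ℂ} (hg : g ∈ polyLine)
    (hh : h ∈ polyLine) (H : ∀ t, g t * h t = 0) {t₀ : ℂ} (h₀ : g t₀ ≠ 0) (t : ℂ) : h t = 0 := by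
  obtain ⟨P, hP⟩ := mem_polyLine_iff.1 hg
  obtain ⟨Q, hQ⟩ := mem_polyLine_iff.1 hh
  have hPQ : P * Q = 0 := Polynomial.funext fun t => by
    rw [Polynomial.eval_mul, ← hP, ← hQ, H, Polynomial.eval_zero]
  rcases mul_eq_zero.1 hPQ with h0 | h0
  · exact absurd (by rw [hP, h0, Polynomial.eval_zero]) h₀
  · rw [hQ, h0, Polynomial.eval_zero]

/-- A curve is polynomial if all its coordinates are. -/
def IsPolyCurve (c : ℂ → V) : Prop :=
  ∀ φ : Module.Dual ℂ V, (fun t => φ (c t)) ∈ polyLine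

theorem IsPolyCurve.comp_mem_polyLine {c : ℂ → V} (hc : IsPolyCurve c) {f : V → ℂ}
    (hf : f ∈ polyFun V) : (fun t => f (c t)) ∈ polyLine := by
  induction hf using Algebra.adjoin_induction with
  | mem f hf => obtain ⟨φ, rfl⟩ := hf; exact hc φ
  | algebraMap r => exact const_mem_polyLine r
  | add f g _ _ hf hg => exact add_mem hf hg
  | mul f g _ _ hf hg => exact mul_mem hf hg

theorem IsPolyCurve.add {c d : ℂ → V} (hc : IsPolyCurve c) (hd : IsPolyCurve d) :
    IsPolyCurve (fun t => c t + d t) := fun φ => by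
  simp only [map_add]
  exact add_mem (hc φ) (hd φ)

theorem IsPolyCurve.smul {g : ℂ → ℂ} {c : ℂ → V} (hg : g ∈ polyLine) (hc : IsPolyCurve c) :
    IsPolyCurve (fun t => g t • c t) := fun φ => by
  simp only [map_smul, smul_eq_mul]
  exact mul_mem hg (hc φ)

theorem IsPolyCurve.sub {c d : ℂ → V} (hc : IsPolyCurve c) (hd : IsPolyCurve d) :
    IsPolyCurve (fun t => c t - d t) := fun φ => by
  simp only [map_sub]
  exact sub_mem (hc φ) (hd φ)

theorem isPolyCurve_const (v : V) : IsPolyCurve (fun _ => v) := fun φ => const_mem_polyLine (φ v)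

theorem isPolyCurve_line (v w : V) :
    IsPolyCurve (fun t => AffineMap.lineMap (k := ℂ) v w t) := by
  simp only [AffineMap.lineMap_apply_module']
  exact ((isPolyCurve_const _).smul id_mem_polyLine).add (isPolyCurve_const _)

/-- A polynomial curve that lies in `S` away from the zeros of a nonzero polynomial lies in the
closure of `S`. -/
theorem IsPolyCurve.mem_zariskiClosure {c : ℂ → V} (hc : IsPolyCurve c) {S : Set V} {g : ℂ → ℂ}
    (hg : g ∈ polyLine) {t₀ : ℂ} (h₀ : g t₀ ≠ 0) (h : ∀ t, g t ≠ 0 → c t ∈ S) (t : ℂ) :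
    c t ∈ zariskiClosure S := by
  refine mem_zariskiClosure_iff.2 fun f hf hS => ?_
  refine eq_zero_of_mul_eq_zero_of_mem_polyLine hg (hc.comp_mem_polyLine hf) (fun s => ?_) h₀ t
  by_cases hs : g s = 0
  · rw [hs, zero_mul]
  · rw [hS _ (h s hs), mul_zero]

/-- A set in which any two points are joined by a polynomial curve is irreducible. -/
theorem isIrreducible_of_isPolyCurve {S : Set V} (hne : S.Nonempty)
    (h : ∀ a ∈ S, ∀ b ∈ S, ∃ c : ℂ → V, IsPolyCurve c ∧ (∀ t, c t ∈ S) ∧ c 0 = a ∧ c 1 = b) :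
    @IsIrreducible V (zariskiTopology V) S := by
  let := zariskiTopology V
  refine ⟨hne, ?_⟩
  rintro U W hU hW ⟨a, ha, haU⟩ ⟨b, hb, hbW⟩
  obtain ⟨_, ⟨f, hf, rfl⟩, hfa, hfU⟩ := isTopologicalBasis_zariski.exists_subset_of_mem_open haU hU
  obtain ⟨_, ⟨g, hg, rfl⟩, hgb, hgW⟩ := isTopologicalBasis_zariski.exists_subset_of_mem_open hbW hW
  obtain ⟨c, hc, hcS, rfl, rfl⟩ := h a ha b hb
  by_contra hcon
  refine hgb (eq_zero_of_mul_eq_zero_of_mem_polyLine (hc.comp_mem_polyLine hf)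
    (hc.comp_mem_polyLine hg) (fun t => ?_) hfa 1)
  by_contra hne
  exact hcon ⟨c t, hcS t, hfU (left_ne_zero_of_mul hne), hgW (right_ne_zero_of_mul hne)⟩

end Zariski

/-- The irreducible components of a finite union of pairwise incomparable irreducible closed
sets. -/
theorem image_val_irreducibleComponents {X ι : Type*} [TopologicalSpace X] [Finite ι]
    {C : ι → Set X} (hcl : ∀ i, IsClosed (C i)) (hirr : ∀ i, IsIrreducible (C i))
    (hinc : ∀ i j, C i ⊆ C j → i = j) {Z : Set X} (hZ : Z = ⋃ i, C i) :
    (fun D : Set Z => (Subtype.val '' D : Set X)) '' irreducibleComponents Z = Set.range C := by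
  classical
  have cover (D : Set Z) (hD : IsIrreducible D) : ∃ i, Subtype.val '' D ⊆ C i := by
    have hD' : IsIrreducible (Subtype.val '' D : Set X) :=
      hD.image _ continuous_subtype_val.continuousOn
    obtain ⟨_, hz, hDz⟩ := isIrreducible_iff_sUnion_isClosed.1 hD'
      (Set.finite_range C).toFinset (by simpa using hcl) (by
        rw [Set.Finite.coe_toFinset, Set.sUnion_range, ← hZ]
        rintro _ ⟨z, -, rfl⟩
        exact z.2)
    obtain ⟨i, rfl⟩ := (Set.Finite.mem_toFinset _).1 hz
    exact ⟨i, hDz⟩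
  have hCZ (i : ι) : C i ⊆ Z := hZ ▸ Set.subset_iUnion C i
  have himg (i : ι) : Subtype.val '' (Subtype.val ⁻¹' C i : Set Z) = C i := by
    rw [Subtype.image_preimage_coe, Set.inter_eq_right]
    exact hCZ i
  have hpre (i : ι) : IsIrreducible (Subtype.val ⁻¹' C i : Set Z) := by
    obtain ⟨⟨x, hx⟩, hC⟩ := hirr i
    refine ⟨⟨⟨x, hCZ i hx⟩, hx⟩, ?_⟩
    rintro _ _ ⟨U, hU, rfl⟩ ⟨W, hW, rfl⟩ ⟨y, hy, hyU⟩ ⟨z, hz, hzW⟩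
    obtain ⟨w, hw, hwUW⟩ := hC U W hU hW ⟨y, hy, hyU⟩ ⟨z, hz, hzW⟩
    exact ⟨⟨w, hCZ i hw⟩, hw, hwUW⟩
  have hmax (i : ι) : (Subtype.val ⁻¹' C i : Set Z) ∈ irreducibleComponents Z := by
    refine ⟨hpre i, fun D hD hle => ?_⟩
    obtain ⟨j, hj⟩ := cover D hD
    have hij : i = j := hinc i j (by
      rw [← himg i]
      exact (Set.image_mono hle).trans hj)
    subst hij
    exact Set.image_subset_iff.1 hj
  apply Set.Subset.antisymm
  · rintro _ ⟨D, hD, rfl⟩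
    obtain ⟨i, hi⟩ := cover D hD.1
    refine ⟨i, ?_⟩
    have : D = Subtype.val ⁻¹' C i := hD.eq_of_le (hpre i) (Set.image_subset_iff.1 hi)
    simp only [this, himg]
  · rintro _ ⟨i, rfl⟩
    exact ⟨_, hmax i, himg i⟩

open Function

/-! ### Complexified inner products. -/

section Forms

variable {m : ℕ} {b : LinearMap.BilinForm ℝ (Fin m → ℝ)}

theorem complexify_apply (b : LinearMap.BilinForm ℝ (Fin m → ℝ)) (x y : Fin m → ℂ) :
    complexify b x y =
      ∑ i, ∑ j, x i * (b (Pi.single i 1) (Pi.single j 1) : ℂ) * y j := by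
  simp [complexify, Matrix.toBilin'_apply, LinearMap.BilinForm.toMatrix'_apply]

theorem complexify_comm (hb : IsInnerProduct b) (x y : Fin m → ℂ) :
    complexify b x y = complexify b y x := by
  rw [complexify_apply, complexify_apply, Finset.sum_comm]
  refine Finset.sum_congr rfl fun i _ => Finset.sum_congr rfl fun j _ => ?_
  rw [hb.1]
  ring

theorem complexify_ofReal (x y : Fin m → ℝ) :
    complexify b (fun i => (x i : ℂ)) (fun i => (y i : ℂ)) = (b x y : ℂ) := by
  have h : b x y = ∑ i, ∑ j, x i * b (Pi.single i 1) (Pi.single j 1) * y j := by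
    rw [← Matrix.toBilin'_toMatrix' b, Matrix.toBilin'_apply]
    simp [LinearMap.BilinForm.toMatrix'_apply]
  rw [complexify_apply, h]
  push_cast
  rfl

theorem exists_complexify_eq_one (hb : IsInnerProduct b) {y : Fin m → ℂ} (hy : y ≠ 0) :
    ∃ v, complexify b v y = 1 := by
  obtain ⟨v, hv⟩ : ∃ v, complexify b v y ≠ 0 := by
    let u : Fin m → ℝ := fun i => (y i).re
    let w : Fin m → ℝ := fun i => (y i).im
    have hyuw : y = (fun i => (u i : ℂ)) + Complex.I • fun i => (w i : ℂ) := by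
      ext i
      simp [u, w, mul_comm Complex.I, Complex.re_add_im]
    have hnn (z : Fin m → ℝ) : 0 ≤ b z z := by
      by_cases hz : z = 0
      · simp [hz]
      · exact (hb.2 z hz).le
    -- The witness is the complex conjugate of `y`, which gives the positive number `b u u + b w w`.
    refine ⟨(fun i => (u i : ℂ)) - Complex.I • fun i => (w i : ℂ), ?_⟩
    rw [hyuw]
    simp only [map_add, map_sub, map_smul, LinearMap.sub_apply, LinearMap.smul_apply,
      complexify_ofReal, smul_eq_mul, hb.1 w u]
    have e : (b u u : ℂ) - Complex.I * b u w + Complex.I * (b u w - Complex.I * b w w) =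
        ((b u u + b w w : ℝ) : ℂ) := by
      push_cast
      linear_combination (-(b w w : ℂ)) * Complex.I_sq
    rw [e, Complex.ofReal_ne_zero]
    intro h0
    have hu : u = 0 := by
      by_contra h
      linarith [hb.2 u h, hnn w]
    have hw : w = 0 := by
      by_contra h
      linarith [hb.2 w h, hnn u]
    apply hy
    rw [hyuw, hu, hw]
    ext i
    simp
  exact ⟨(complexify b v y)⁻¹ • v, by simp [hv]⟩

/-- An orthonormal pair of vectors. -/
theorem exists_orthonormal_pair (hm : 2 ≤ m) (hb : IsInnerProduct b) :
    ∃ e f, complexify b e e = 1 ∧ complexify b f f = 1 ∧ complexify b e f = 0 := by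
  have normalize (x : Fin m → ℝ) (hx : x ≠ 0) : ∃ c : ℝ, b (c • x) (c • x) = 1 := by
    refine ⟨(√(b x x))⁻¹, ?_⟩
    have h := hb.2 x hx
    have h2 := Real.mul_self_sqrt h.le
    have h3 : √(b x x) ≠ 0 := (Real.sqrt_pos.2 h).ne'
    simp only [map_smul, LinearMap.smul_apply, smul_eq_mul]
    field_simp
    rw [sq, h2]
  let i₀ : Fin m := ⟨0, by omega⟩
  let i₁ : Fin m := ⟨1, by omega⟩
  have hi : i₁ ≠ i₀ := by simp [i₀, i₁]
  let x : Fin m → ℝ := Pi.single i₀ 1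
  have hx : x ≠ 0 := by simp [x]
  -- Gram–Schmidt without division; the coordinate of `y` at `i₁` is `b x x`, which shows that `y ≠
  -- 0`.
  let y : Fin m → ℝ := b x x • Pi.single i₁ 1 - b x (Pi.single i₁ 1) • x
  have hxx := hb.2 x hx
  have hy : y ≠ 0 := fun h => by
    have := congrFun h i₁
    simp [y, x, hi] at this
    exact hxx.ne' this
  have hxy : b x y = 0 := by
    simp only [y, map_sub, map_smul, smul_eq_mul]
    ring
  obtain ⟨c, hc⟩ := normalize x hx
  obtain ⟨d, hd⟩ := normalize y hy
  refine ⟨fun i => ((c • x) i : ℂ), fun i => ((d • y) i : ℂ), ?_, ?_, ?_⟩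
  · rw [complexify_ofReal, hc, Complex.ofReal_one]
  · rw [complexify_ofReal, hd, Complex.ofReal_one]
  · rw [complexify_ofReal]
    simp [hxy]

theorem complexify_comp_mem_polyFun {V : Type*} [AddCommGroup V] [Module ℂ V]
    (L M : V →ₗ[ℂ] Fin m → ℂ) : (fun T => complexify b (L T) (M T)) ∈ polyFun V := by
  have : (fun T => complexify b (L T) (M T)) = ∑ i, ∑ j,
      ((LinearMap.proj i ∘ₗ L : Module.Dual ℂ V) : V → ℂ) *
        (algebraMap ℂ (V → ℂ) (b (Pi.single i 1) (Pi.single j 1))) *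
        ((LinearMap.proj j ∘ₗ M : Module.Dual ℂ V) : V → ℂ) := by
    ext T
    simp [complexify_apply]
  rw [this]
  exact sum_mem fun i _ => sum_mem fun j _ => mul_mem (mul_mem (dual_mem_polyFun _)
    (Subalgebra.algebraMap_mem _ _)) (dual_mem_polyFun _)

theorem complexify_curve_mem_polyLine {c d : ℂ → Fin m → ℂ} (hc : IsPolyCurve c)
    (hd : IsPolyCurve d) : (fun t => complexify b (c t) (d t)) ∈ polyLine := by
  have : (fun t => complexify b (c t) (d t)) = ∑ i, ∑ j,
      (fun t => (LinearMap.proj i : Module.Dual ℂ (Fin m → ℂ)) (c t)) *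
        (fun _ => (b (Pi.single i 1) (Pi.single j 1) : ℂ)) *
        (fun t => (LinearMap.proj j : Module.Dual ℂ (Fin m → ℂ)) (d t)) := by
    ext t
    simp [complexify_apply]
  rw [this]
  exact sum_mem fun i _ => sum_mem fun j _ => mul_mem (mul_mem (hc _)
    (const_mem_polyLine _)) (hd _)

end Forms

/-! ### Functionals, contractions and contracted minors on the tensor space. -/

section Tensors

variable {p : ℕ} {n : Fin p → ℕ}

/-- Expanding in the standard bases turns each coordinate into a finite sum of products of
coordinates of the factors. -/
theorem IsPolyCurve.tprod {c : ∀ k, ℂ → Fin (n k) → ℂ} (hc : ∀ k, IsPolyCurve (c k)) :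
    IsPolyCurve (fun t => ⨂ₜ[ℂ] k, c k t) := by
  intro φ
  have h (t : ℂ) : φ (⨂ₜ[ℂ] k, c k t) =
      ∑ r : ∀ k, Fin (n k), (∏ k, c k t (r k)) * φ (⨂ₜ[ℂ] k, Pi.single (r k) 1) := by
    have h1 : (fun k => c k t) = fun k => ∑ j, c k t j • (Pi.single j 1 : Fin (n k) → ℂ) :=
      funext fun k => pi_eq_sum_univ' (c k t)
    rw [h1, MultilinearMap.map_sum, map_sum]
    refine Finset.sum_congr rfl fun r _ => ?_
    rw [MultilinearMap.map_smul_univ, map_smul, smul_eq_mul]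
  have h2 : (fun t => φ (⨂ₜ[ℂ] k, c k t)) = ∑ r : ∀ k, Fin (n k),
      (∏ k, fun t => (LinearMap.proj (r k) : Module.Dual ℂ (Fin (n k) → ℂ)) (c k t)) *
        fun _ => φ (⨂ₜ[ℂ] k, Pi.single (r k) 1) := by
    ext t
    simp [h t]
  rw [h2]
  exact sum_mem fun r _ => mul_mem (prod_mem fun k _ => hc k _) (const_mem_polyLine _)

/-- The functional on the tensor space that is the tensor product of functionals on the factors. -/
def tensorFunctional (ψ : ∀ k, Module.Dual ℂ (Fin (n k) → ℂ)) : Module.Dual ℂ (TensorSpace n) :=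
  PiTensorProduct.dualDistrib (⨂ₜ[ℂ] k, ψ k)

theorem tensorFunctional_tprod (ψ : ∀ k, Module.Dual ℂ (Fin (n k) → ℂ))
    (z : ∀ k, Fin (n k) → ℂ) : tensorFunctional ψ (⨂ₜ[ℂ] k, z k) = ∏ k, ψ k (z k) :=
  PiTensorProduct.dualDistrib_apply _ _

theorem prod_update_apply (ψ : ∀ k, Module.Dual ℂ (Fin (n k) → ℂ)) (i : Fin p)
    (μ : Module.Dual ℂ (Fin (n i) → ℂ)) (z : ∀ k, Fin (n k) → ℂ) :
    ∏ k, update ψ i μ k (z k) = μ (z i) * ∏ k ∈ Finset.univ.erase i, ψ k (z k) := by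
  rw [← Finset.mul_prod_erase _ _ (Finset.mem_univ i), update_self]
  congr 1
  refine Finset.prod_congr rfl fun k hk => ?_
  rw [update_of_ne (Finset.ne_of_mem_erase hk)]

theorem tprod_ne_zero {z : ∀ k, Fin (n k) → ℂ} (hz : ∀ k, z k ≠ 0) :
    (⨂ₜ[ℂ] k, z k) ≠ 0 := by
  have h (k : Fin p) : ∃ ψ : Module.Dual ℂ (Fin (n k) → ℂ), ψ (z k) ≠ 0 := by
    by_contra! h
    exact hz k ((Module.forall_dual_apply_eq_zero_iff ℂ _).1 h)
  choose ψ hψ using h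
  intro h0
  have := tensorFunctional_tprod ψ z
  rw [h0, map_zero] at this
  exact Finset.prod_ne_zero_iff.2 (fun k _ => hψ k) this.symm

theorem tprod_eq_zero {z : ∀ k, Fin (n k) → ℂ} (i : Fin p) (h : z i = 0) :
    (⨂ₜ[ℂ] k, z k) = 0 :=
  MultilinearMap.map_coord_zero _ i h

/-- The contraction of a tensor with functionals in all factors except the `k`-th one. -/
def contraction (k : Fin p) (ψ : ∀ k, Module.Dual ℂ (Fin (n k) → ℂ)) :
    TensorSpace n →ₗ[ℂ] (Fin (n k) → ℂ) :=
  LinearMap.pi fun a => tensorFunctional (update ψ k (LinearMap.proj a))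

theorem contraction_tprod (k : Fin p) (ψ : ∀ k, Module.Dual ℂ (Fin (n k) → ℂ))
    (z : ∀ k, Fin (n k) → ℂ) :
    contraction k ψ (⨂ₜ[ℂ] s, z s) = (∏ s ∈ Finset.univ.erase k, ψ s (z s)) • z k := by
  ext a
  rw [contraction, LinearMap.pi_apply, tensorFunctional_tprod, prod_update_apply]
  simp [mul_comm]

/-- A `2 × 2` minor in the factors `a`, `b` of the contraction of two copies of a tensor by the
bilinear form of the factor `s`. -/
def contractedMinor (B : ∀ i, LinearMap.BilinForm ℝ (Fin (n i) → ℝ)) (s a b : Fin p)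
    (ψ : ∀ k, Module.Dual ℂ (Fin (n k) → ℂ)) (μ μ' : Module.Dual ℂ (Fin (n a) → ℂ))
    (ν ν' : Module.Dual ℂ (Fin (n b) → ℂ)) (T : TensorSpace n) : ℂ :=
  complexify (B s) (contraction s (update (update ψ a μ) b ν) T)
      (contraction s (update (update ψ a μ') b ν') T) -
    complexify (B s) (contraction s (update (update ψ a μ) b ν') T)
      (contraction s (update (update ψ a μ') b ν) T)

variable {B : ∀ i, LinearMap.BilinForm ℝ (Fin (n i) → ℝ)} {s a b : Fin p}
  {ψ : ∀ k, Module.Dual ℂ (Fin (n k) → ℂ)} {μ μ' : Module.Dual ℂ (Fin (n a) → ℂ)}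
  {ν ν' : Module.Dual ℂ (Fin (n b) → ℂ)}

theorem contractedMinor_mem_polyFun :
    contractedMinor B s a b ψ μ μ' ν ν' ∈ polyFun (TensorSpace n) :=
  sub_mem (complexify_comp_mem_polyFun _ _) (complexify_comp_mem_polyFun _ _)

theorem contraction_update_tprod (hsa : a ≠ s) (hsb : b ≠ s) (hab : a ≠ b)
    (μ : Module.Dual ℂ (Fin (n a) → ℂ)) (ν : Module.Dual ℂ (Fin (n b) → ℂ))
    (z : ∀ k, Fin (n k) → ℂ) :
    contraction s (update (update ψ a μ) b ν) (⨂ₜ[ℂ] k, z k) =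
      (μ (z a) * ν (z b) *
        ∏ k ∈ ((Finset.univ.erase s).erase b).erase a, ψ k (z k)) • z s := by
  rw [contraction_tprod, ← Finset.mul_prod_erase _ _ (show b ∈ Finset.univ.erase s by simp [hsb]),
    ← Finset.mul_prod_erase _ _ (show a ∈ (Finset.univ.erase s).erase b by simp [hsa, hab]),
    update_self, update_of_ne hab, update_self,
    Finset.prod_congr rfl (g := fun k => ψ k (z k))]
  · congr 1
    ring
  · intro k hk
    simp only [Finset.mem_erase] at hk
    rw [update_of_ne hk.2.1, update_of_ne hk.1]

/-- The minor vanishes on sums of rank-one tensors that are pairwise orthogonal in the factor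
`s`. -/
theorem contractedMinor_sum_eq_zero (hsa : a ≠ s) (hsb : b ≠ s) (hab : a ≠ b) {m : ℕ}
    {x : Fin m → ∀ k, Fin (n k) → ℂ}
    (hx : ∀ k l, k ≠ l → complexify (B s) (x k s) (x l s) = 0) :
    contractedMinor B s a b ψ μ μ' ν ν' (∑ l, ⨂ₜ[ℂ] k, x l k) = 0 := by
  -- Only diagonal terms survive, so the value depends on the products `c l * d l` alone. These do
  -- not change when `ν` and `ν'` are exchanged, so the two terms of the minor cancel.
  have key (c d : Fin m → ℂ) :
      complexify (B s) (∑ l, c l • x l s) (∑ l, d l • x l s) =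
        ∑ l, c l * d l * complexify (B s) (x l s) (x l s) := by
    simp only [map_sum, LinearMap.sum_apply, map_smul, LinearMap.smul_apply, smul_eq_mul]
    refine Finset.sum_congr rfl fun l _ => ?_
    rw [Finset.sum_eq_single l]
    · ring
    · intro k _ hk
      rw [hx k l hk, mul_zero]
    · simp
  have hcon (μ : Module.Dual ℂ (Fin (n a) → ℂ)) (ν : Module.Dual ℂ (Fin (n b) → ℂ)) :=
    (map_sum (contraction s (update (update ψ a μ) b ν)) (fun l => ⨂ₜ[ℂ] k, x l k)
      Finset.univ).trans
      (Finset.sum_congr rfl fun l _ => contraction_update_tprod hsa hsb hab μ ν (x l))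
  simp only [contractedMinor, hcon]
  rw [key, key, sub_eq_zero]
  refine Finset.sum_congr rfl fun l _ => ?_
  ring

/-- The terms with `⟨u_s, u_s⟩` and `⟨v_s, v_s⟩` cancel, and the cross terms factor. When the
factors `a` and `b` are independent, the functionals can be chosen so that this detects `⟨u_s,
v_s⟩`. -/
theorem contractedMinor_add (hB : IsInnerProduct (B s)) (hsa : a ≠ s) (hsb : b ≠ s) (hab : a ≠ b)
    (u v : ∀ k, Fin (n k) → ℂ) :
    contractedMinor B s a b ψ μ μ' ν ν' ((⨂ₜ[ℂ] k, u k) + ⨂ₜ[ℂ] k, v k) =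
      (μ (u a) * μ' (v a) - μ (v a) * μ' (u a)) * (ν (u b) * ν' (v b) - ν (v b) * ν' (u b)) *
      ((∏ k ∈ ((Finset.univ.erase s).erase b).erase a, ψ k (u k)) *
        ∏ k ∈ ((Finset.univ.erase s).erase b).erase a, ψ k (v k)) *
      complexify (B s) (u s) (v s) := by
  simp only [contractedMinor, map_add, contraction_update_tprod hsa hsb hab, LinearMap.add_apply,
    map_smul, LinearMap.smul_apply, smul_eq_mul, complexify_comm hB (v s) (u s)]
  ring

end Tensors

/-! ### Tangent and normal spaces of the rank-one variety. -/

section Tangent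

variable {V : Type*} [AddCommGroup V] [Module ℂ V]

/-- A linear automorphism that preserves `X` carries tangent spaces into tangent spaces. -/
theorem map_tangentSpace_le {X : Set V} (g : V ≃ₗ[ℂ] V) (hg : ∀ z ∈ X, g z ∈ X) (x : V) :
    (tangentSpace X x).map (g : V →ₗ[ℂ] V) ≤ tangentSpace X (g x) := by
  rintro _ ⟨v, hv, rfl⟩ f hf hX
  have hfg : f ∘ g ∈ polyFun V := by
    clear hX
    induction hf using Algebra.adjoin_induction with
    | mem f hf => obtain ⟨φ, rfl⟩ := hf; exact dual_mem_polyFun (φ ∘ₗ (g : V →ₗ[ℂ] V))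
    | algebraMap r => exact Subalgebra.algebraMap_mem _ r
    | add f g _ _ hf hg => exact add_mem hf hg
    | mul f g _ _ hf hg => exact mul_mem hf hg
  have h := hv _ hfg fun z hz => hX _ (hg z hz)
  simpa [lineDeriv] using h

theorem mem_tangentSpace_of_line {X : Set V} {x v : V} (h : ∀ t : ℂ, x + t • v ∈ X) :
    v ∈ tangentSpace X x := by
  intro f _ hX
  have : (fun t : ℂ => f (x + t • v)) = fun _ => 0 := funext fun t => hX _ (h t)
  rw [lineDeriv, this, deriv_const]

end Tangent

variable {p : ℕ} {n : Fin p → ℕ}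

theorem add_smul_update_mem_rankOne (x : ∀ k, Fin (n k) → ℂ) (k : Fin p) (v : Fin (n k) → ℂ)
    (t : ℂ) : (⨂ₜ[ℂ] s, x s) + t • (⨂ₜ[ℂ] s, update x k v s) ∈ rankOne n := by
  refine ⟨update x k (x k + t • v), ?_⟩
  rw [MultilinearMap.map_update_add, MultilinearMap.map_update_smul, update_eq_self]

/-- The rank-one tensors form a cone, so each of them is tangent at the vertex, and they span the
space. -/
theorem tangentSpace_rankOne_zero (hp : 0 < p) : tangentSpace (rankOne n) 0 = ⊤ := by
  rw [eq_top_iff, ← PiTensorProduct.span_tprod_eq_top, Submodule.span_le]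
  rintro _ ⟨x, rfl⟩
  refine mem_tangentSpace_of_line fun t => ⟨update x ⟨0, hp⟩ (t • x ⟨0, hp⟩), ?_⟩
  rw [MultilinearMap.map_update_smul, update_eq_self, zero_add]

/-- Products of linear automorphisms of the factors act transitively on nonzero rank-one tensors and
transport tangent spaces, so the dimension is the same at all of these. At `0` it is as large as
possible. -/
theorem tprod_mem_regularLocus (hp : 0 < p) {x : ∀ k, Fin (n k) → ℂ} (hx : ∀ k, x k ≠ 0) :
    (⨂ₜ[ℂ] k, x k) ∈ regularLocus (rankOne n) := by
  refine ⟨⟨x, rfl⟩, ?_⟩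
  rintro _ ⟨z, rfl⟩
  by_cases hz : ∀ k, z k ≠ 0
  · choose g hg using fun k => SeparatingDual.exists_continuousLinearEquiv_apply_eq (R := ℂ)
      (hx k) (hz k)
    let G : TensorSpace n ≃ₗ[ℂ] TensorSpace n :=
      PiTensorProduct.congr fun k => (g k).toLinearEquiv
    have hG (y : ∀ k, Fin (n k) → ℂ) : G (⨂ₜ[ℂ] k, y k) = ⨂ₜ[ℂ] k, g k (y k) :=
      PiTensorProduct.congr_tprod _ _
    have hGx : G (⨂ₜ[ℂ] k, x k) = ⨂ₜ[ℂ] k, z k := by simp only [hG, hg]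
    have h := Submodule.finrank_mono (map_tangentSpace_le (X := rankOne n) G
      (by rintro _ ⟨y, rfl⟩; exact ⟨_, hG y⟩) (⨂ₜ[ℂ] k, x k))
    rwa [hGx, LinearEquiv.finrank_map_eq] at h
  · push Not at hz
    obtain ⟨k, hk⟩ := hz
    rw [tprod_eq_zero k hk, tangentSpace_rankOne_zero hp]
    exact Submodule.finrank_mono le_top

variable {B : ∀ i, LinearMap.BilinForm ℝ (Fin (n i) → ℝ)}

/-- The sums of two tensors of rank at most one that are orthogonal in the factors `i` and `j`. -/
def pairSet (B : ∀ i, LinearMap.BilinForm ℝ (Fin (n i) → ℝ)) (i j : Fin p) :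
    Set (TensorSpace n) :=
  {T | ∃ x y : ∀ k, Fin (n k) → ℂ,
    complexify (B i) (x i) (y i) = 0 ∧ complexify (B j) (x j) (y j) = 0 ∧
    T = (⨂ₜ[ℂ] k, x k) + ⨂ₜ[ℂ] k, y k}

theorem pairLocus_eq (i j : Fin p) : pairLocus B i j = zariskiClosure (pairSet B i j) := rfl

theorem pairSet_comm (i j : Fin p) : pairSet B i j = pairSet B j i := by
  ext T
  exact ⟨fun ⟨x, y, h, h', e⟩ => ⟨x, y, h', h, e⟩, fun ⟨x, y, h, h', e⟩ => ⟨x, y, h', h, e⟩⟩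

/-- A rank-one tensor that is orthogonal to the tangent space at `⊗ x_k` is orthogonal to `⊗ x_k`
in at least two factors. -/
theorem exists_orthogonal_pair (hp : 0 < p) (hB : ∀ i, IsInnerProduct (B i))
    {x y : ∀ k, Fin (n k) → ℂ} (hy : ∀ k, y k ≠ 0)
    (h : (⨂ₜ[ℂ] k, y k) ∈ normalSpace (bombieriWeyl B) (rankOne n) (⨂ₜ[ℂ] k, x k)) :
    ∃ i j, i ≠ j ∧ complexify (B i) (x i) (y i) = 0 ∧ complexify (B j) (x j) (y j) = 0 := by
  have key (k : Fin p) : ∃ i, i ≠ k ∧ complexify (B i) (x i) (y i) = 0 := by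
    obtain ⟨v, hv⟩ := exists_complexify_eq_one (hB k) (hy k)
    have h0 : bombieriWeyl B (⨂ₜ[ℂ] s, update x k v s) (⨂ₜ[ℂ] s, y s) = 0 :=
      h _ (mem_tangentSpace_of_line (add_smul_update_mem_rankOne x k v))
    rw [bombieriWeyl_tprod, Finset.prod_eq_zero_iff] at h0
    obtain ⟨i, -, hi⟩ := h0
    have hik : i ≠ k := by
      rintro rfl
      rw [update_self, hv] at hi
      exact one_ne_zero hi
    rw [update_of_ne hik] at hi
    exact ⟨i, hik, hi⟩
  -- The first omission produces an orthogonal factor `i`; omitting `i` itself then produces a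
  -- different one.
  obtain ⟨i, -, hi⟩ := key ⟨0, hp⟩
  obtain ⟨j, hji, hj⟩ := key i
  exact ⟨i, j, hji.symm, hi, hj⟩

/-- A rank-one tensor that is orthogonal to a nonzero `⊗ x_k` in two factors is orthogonal to the
tangent space at `⊗ x_k`. -/
theorem tprod_mem_normalSpace {x y : ∀ k, Fin (n k) → ℂ} (hx : ∀ k, x k ≠ 0) {i j : Fin p}
    (hij : i ≠ j) (hi : complexify (B i) (x i) (y i) = 0)
    (hj : complexify (B j) (x j) (y j) = 0) :
    (⨂ₜ[ℂ] k, y k) ∈ normalSpace (bombieriWeyl B) (rankOne n) (⨂ₜ[ℂ] k, x k) := by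
  intro v hv
  change bombieriWeyl B v (⨂ₜ[ℂ] k, y k) = 0
  have hα (k : Fin p) : ∃ α : Module.Dual ℂ (Fin (n k) → ℂ), α (x k) ≠ 0 := by
    by_contra! h
    exact hx k ((Module.forall_dual_apply_eq_zero_iff ℂ _).1 h)
  choose α hα using hα
  let β (k : Fin p) : Module.Dual ℂ (Fin (n k) → ℂ) := (complexify (B k)).flip (y k)
  let L := (bombieriWeyl B).flip (⨂ₜ[ℂ] k, y k)
  have hL (z : ∀ k, Fin (n k) → ℂ) : L (⨂ₜ[ℂ] k, z k) = ∏ k, β k (z k) :=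
    bombieriWeyl_tprod B z y
  let A := tensorFunctional α
  let L' := tensorFunctional (update β i (α i))
  let A' := tensorFunctional (update α i (β i))
  -- `L'` and `A'` arise from `L` and `A` by exchanging the functionals in the factor `i`, so `f`
  -- vanishes on rank-one tensors. At `⊗ x_k` the values of `L`, `L'` and `A'` are zero, by
  -- orthogonality in `i` and `j`, so the differential of `f` is `A(⊗ x_k) • L` with nonzero
  -- coefficient. Tangent vectors must therefore be killed by `L`, and the tangent space need not be
  -- computed.
  let f : TensorSpace n → ℂ := (L : TensorSpace n → ℂ) * A - (L' : TensorSpace n → ℂ) * A'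
  have hf : f ∈ polyFun (TensorSpace n) :=
    sub_mem (mul_mem (dual_mem_polyFun _) (dual_mem_polyFun _))
      (mul_mem (dual_mem_polyFun _) (dual_mem_polyFun _))
  have hfX : ∀ z ∈ rankOne n, f z = 0 := by
    rintro _ ⟨z, rfl⟩
    simp only [f, Pi.sub_apply, Pi.mul_apply, hL, A, L', A', tensorFunctional_tprod,
      prod_update_apply]
    rw [← Finset.mul_prod_erase _ _ (Finset.mem_univ i),
      ← Finset.mul_prod_erase _ (fun k => α k (z k)) (Finset.mem_univ i)]
    ring
  have hLx : L (⨂ₜ[ℂ] k, x k) = 0 := by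
    rw [hL]
    exact Finset.prod_eq_zero (Finset.mem_univ i) hi
  have hL'x : L' (⨂ₜ[ℂ] k, x k) = 0 := by
    rw [tensorFunctional_tprod, prod_update_apply,
      Finset.prod_eq_zero (Finset.mem_erase.2 ⟨hij.symm, Finset.mem_univ j⟩) hj, mul_zero]
  have hA'x : A' (⨂ₜ[ℂ] k, x k) = 0 := by
    rw [tensorFunctional_tprod, prod_update_apply, show β i (x i) = 0 from hi, zero_mul]
  have hAx : A (⨂ₜ[ℂ] k, x k) ≠ 0 := by
    rw [tensorFunctional_tprod]
    exact Finset.prod_ne_zero_iff.2 fun k _ => hα k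
  have hlin (φ : Module.Dual ℂ (TensorSpace n)) (t : ℂ) :
      φ ((⨂ₜ[ℂ] k, x k) + t • v) = φ (⨂ₜ[ℂ] k, x k) + t * φ v := by simp
  have hd : lineDeriv ℂ f (⨂ₜ[ℂ] k, x k) v = L v * A (⨂ₜ[ℂ] k, x k) := by
    have e : (fun t : ℂ => f ((⨂ₜ[ℂ] k, x k) + t • v)) = fun t =>
        t * (L v * A (⨂ₜ[ℂ] k, x k)) + t ^ 2 * (L v * A v - L' v * A' v) := by
      ext t
      simp only [f, Pi.sub_apply, Pi.mul_apply, hlin, hLx, hL'x, hA'x]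
      ring
    rw [lineDeriv, e]
    have h1 := ((hasDerivAt_id (0 : ℂ)).mul_const (L v * A (⨂ₜ[ℂ] k, x k))).add
      (((hasDerivAt_id (0 : ℂ)).pow 2).mul_const (L v * A v - L' v * A' v))
    refine HasDerivAt.deriv (h1.congr_deriv ?_)
    simp
  have h0 := hv f hf hfX
  rw [hd] at h0
  exact (mul_eq_zero.1 h0).resolve_right hAx

/-! ### The data locus as a union of pair loci. -/

theorem zero_mem_rankOne (hp : 0 < p) : (0 : TensorSpace n) ∈ rankOne n :=
  ⟨0, (tprod_eq_zero ⟨0, hp⟩ rfl).symm⟩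

theorem DL2_eq_iUnion (hp : 2 ≤ p) (hn : ∀ i, 2 ≤ n i) (hB : ∀ i, IsInnerProduct (B i)) :
    DL2 B = ⋃ s : {s : Fin p × Fin p // s.1 < s.2}, pairLocus B s.1.1 s.1.2 := by
  have hp0 : 0 < p := by omega
  apply Set.Subset.antisymm
  · have hcl : @IsClosed _ (zariskiTopology (TensorSpace n))
        (⋃ s : {s : Fin p × Fin p // s.1 < s.2}, pairLocus B s.1.1 s.1.2) := by
      let := zariskiTopology (TensorSpace n)
      exact isClosed_iUnion_of_finite fun s => isClosed_zariskiClosure _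
    refine @closure_minimal _ (zariskiTopology (TensorSpace n)) _ _ ?_ hcl
    have hsub {i j : Fin p} (hij : i ≠ j) {T : TensorSpace n} (hT : T ∈ pairSet B i j) :
        T ∈ ⋃ s : {s : Fin p × Fin p // s.1 < s.2}, pairLocus B s.1.1 s.1.2 := by
      rcases lt_or_gt_of_ne hij with h | h
      · exact Set.mem_iUnion.2 ⟨⟨(i, j), h⟩, subset_zariskiClosure _ hT⟩
      · exact Set.mem_iUnion.2 ⟨⟨(j, i), h⟩, subset_zariskiClosure (pairSet B j i) (by rwa [pairSet_comm])⟩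
    rintro T ⟨_, ⟨⟨⟨x, rfl⟩, -⟩, hN⟩, y, hy⟩
    rw [hy] at hN
    have hT : T = (⨂ₜ[ℂ] k, x k) + ⨂ₜ[ℂ] k, y k := by rw [← hy]; abel
    by_cases hy0 : ∀ k, y k ≠ 0
    · obtain ⟨i, j, hij, hi, hj⟩ := exists_orthogonal_pair hp0 hB hy0 hN
      exact hsub hij ⟨x, y, hi, hj, hT⟩
    · push Not at hy0
      obtain ⟨k, hk⟩ := hy0
      -- Here the remainder is zero, so `T` has rank at most one and lies in every pair locus; the
      -- factors `0` and `1` are an arbitrary choice.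
      refine hsub (i := ⟨0, by omega⟩) (j := ⟨1, by omega⟩) (by simp) ⟨x, 0, ?_, ?_, ?_⟩
      · simp
      · simp
      · rw [hT, tprod_eq_zero k hk, tprod_eq_zero (z := 0) k rfl]
  · refine Set.iUnion_subset ?_
    rintro ⟨⟨i, j⟩, hij⟩
    refine zariskiClosure_subset ?_
    rintro _ ⟨x, y, hi, hj, rfl⟩
    -- A nonzero rank-one tensor is its own critical approximation, with remainder `0`.
    have hone {z : ∀ k, Fin (n k) → ℂ} (hz : ∀ k, z k ≠ 0) : (⨂ₜ[ℂ] k, z k) ∈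
        {T | ∃ x, IsCriticalRankOneApprox B T x ∧ T - x ∈ rankOne n} := by
      refine ⟨_, ⟨tprod_mem_regularLocus hp0 hz, ?_⟩, ?_⟩
      · rw [sub_self]; exact zero_mem _
      · rw [sub_self]; exact zero_mem_rankOne hp0
    by_cases hx : ∀ k, x k ≠ 0
    · refine subset_zariskiClosure _ ⟨_, ⟨tprod_mem_regularLocus hp0 hx, ?_⟩, y, ?_⟩
      · rw [add_sub_cancel_left]
        exact tprod_mem_normalSpace hx hij.ne hi hj
      · rw [add_sub_cancel_left]
    push Not at hx
    obtain ⟨k, hk⟩ := hx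
    rw [tprod_eq_zero k hk, zero_add]
    by_cases hy : ∀ k, y k ≠ 0
    · exact subset_zariskiClosure _ (hone hy)
    push Not at hy
    obtain ⟨l, hl⟩ := hy
    rw [tprod_eq_zero l hl]
    -- The zero tensor is reached as the limit of `t • ⊗ z_k` for `t → 0`.
    let z : ∀ k, Fin (n k) → ℂ := fun k => Pi.single ⟨0, by have := hn k; omega⟩ 1
    have hz (k : Fin p) : z k ≠ 0 := by simp [z]
    have hc := ((isPolyCurve_const (⨂ₜ[ℂ] k, z k)).smul id_mem_polyLine).mem_zariskiClosure
      (S := {T | ∃ x, IsCriticalRankOneApprox B T x ∧ T - x ∈ rankOne n})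
      id_mem_polyLine (t₀ := 1) one_ne_zero (fun t ht => ?_) 0
    · rwa [zero_smul] at hc
    · have := hone (z := update z k (t • z k)) fun s => by
        by_cases hs : s = k
        · subst hs; rw [update_self]; exact smul_ne_zero ht (hz s)
        · rw [update_of_ne hs]; exact hz s
      rwa [MultilinearMap.map_update_smul, update_eq_self] at this

/-! ### Irreducibility and incomparability of the pair loci. -/

/-- The pairs of vectors orthogonal in two factors are parametrized by a vector space. -/
theorem mem_pairSet_iff (hB : ∀ i, IsInnerProduct (B i)) {i j : Fin p} {T : TensorSpace n} :
    T ∈ pairSet B i j ↔ ∃ x y w : ∀ k, Fin (n k) → ℂ,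
      T = (⨂ₜ[ℂ] k, if k = i ∨ k = j then
        complexify (B k) (w k) (y k) • x k - complexify (B k) (x k) (y k) • w k else x k) +
        ⨂ₜ[ℂ] k, y k := by
  constructor
  · rintro ⟨x, y, hi, hj, rfl⟩
    -- If `y_i` or `y_j` vanishes, no `w` with `⟨w, y⟩ = 1` exists there. But then the second
    -- summand is zero, and `⊗ x_k` can take its place. Otherwise such a `w` makes the projection
    -- formula return `x`.
    by_cases hy : y i = 0 ∨ y j = 0
    · refine ⟨0, x, 0, ?_⟩
      rw [tprod_eq_zero (z := fun k => ite _ _ _) i (by simp), zero_add]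
      rcases hy with h | h
      · rw [tprod_eq_zero i h, add_zero]
      · rw [tprod_eq_zero j h, add_zero]
    · push Not at hy
      have hw (k : Fin p) : ∃ w, (k = i ∨ k = j) → complexify (B k) w (y k) = 1 := by
        by_cases hk : k = i ∨ k = j
        · obtain ⟨w, hw⟩ := exists_complexify_eq_one (hB k) (y := y k) (by
            rcases hk with rfl | rfl
            exacts [hy.1, hy.2])
          exact ⟨w, fun _ => hw⟩
        · exact ⟨0, fun h => absurd h hk⟩
      choose w hw using hw
      refine ⟨x, y, w, ?_⟩
      congr 2
      ext1 k
      split_ifs with hk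
      · rw [hw k hk, one_smul]
        rcases hk with rfl | rfl
        · rw [hi, zero_smul, sub_zero]
        · rw [hj, zero_smul, sub_zero]
      · rfl
  · rintro ⟨x, y, w, rfl⟩
    refine ⟨_, y, ?_, ?_, rfl⟩
    · simp only [true_or, if_true, map_sub, map_smul, LinearMap.sub_apply, LinearMap.smul_apply,
        smul_eq_mul]
      ring
    · simp only [or_true, if_true, map_sub, map_smul, LinearMap.sub_apply, LinearMap.smul_apply,
        smul_eq_mul]
      ring

/-- Linear interpolation of the parameters `x`, `y`, `w` joins two points by a polynomial curve that
never leaves the defining set. -/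
theorem isIrreducible_pairLocus (hB : ∀ i, IsInnerProduct (B i)) (i j : Fin p) :
    @IsIrreducible _ (zariskiTopology (TensorSpace n)) (pairLocus B i j) := by
  let := zariskiTopology (TensorSpace n)
  refine IsIrreducible.closure (isIrreducible_of_isPolyCurve ⟨_, 0, 0, by simp, by simp, rfl⟩ ?_)
  intro a ha b hb
  obtain ⟨x, y, w, rfl⟩ := (mem_pairSet_iff hB).1 ha
  obtain ⟨x', y', w', rfl⟩ := (mem_pairSet_iff hB).1 hb
  let X (k : Fin p) (t : ℂ) := AffineMap.lineMap (k := ℂ) (x k) (x' k) t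
  let Y (k : Fin p) (t : ℂ) := AffineMap.lineMap (k := ℂ) (y k) (y' k) t
  let W (k : Fin p) (t : ℂ) := AffineMap.lineMap (k := ℂ) (w k) (w' k) t
  have hX (k : Fin p) : IsPolyCurve (X k) := isPolyCurve_line _ _
  have hY (k : Fin p) : IsPolyCurve (Y k) := isPolyCurve_line _ _
  have hW (k : Fin p) : IsPolyCurve (W k) := isPolyCurve_line _ _
  refine ⟨fun t => (⨂ₜ[ℂ] k, if k = i ∨ k = j then complexify (B k) (W k t) (Y k t) • X k t -
    complexify (B k) (X k t) (Y k t) • W k t else X k t) + ⨂ₜ[ℂ] k, Y k t, ?_,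
    fun t => (mem_pairSet_iff hB).2 ⟨_, _, _, rfl⟩, by simp [X, Y, W], by simp [X, Y, W]⟩
  refine .add (IsPolyCurve.tprod (c := fun k t => ite _ _ _) fun k => ?_) (.tprod hY)
  split_ifs
  · exact .sub (.smul (complexify_curve_mem_polyLine (hW k) (hY k)) (hX k))
      (.smul (complexify_curve_mem_polyLine (hX k) (hY k)) (hW k))
  · exact hX k

theorem contractedMinor_eq_zero_of_mem_pairLocus (hB : ∀ i, IsInnerProduct (B i))
    {s l a b : Fin p} (hsa : a ≠ s) (hsb : b ≠ s) (hab : a ≠ b)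
    (ψ : ∀ k, Module.Dual ℂ (Fin (n k) → ℂ)) (μ μ' : Module.Dual ℂ (Fin (n a) → ℂ))
    (ν ν' : Module.Dual ℂ (Fin (n b) → ℂ)) {T : TensorSpace n} (hT : T ∈ pairLocus B s l) :
    contractedMinor B s a b ψ μ μ' ν ν' T = 0 := by
  refine mem_zariskiClosure_iff.1 hT _ contractedMinor_mem_polyFun ?_
  rintro _ ⟨x, y, hs, -, rfl⟩
  rw [contractedMinor_add (hB s) hsa hsb hab, hs, mul_zero]

/-- The separating tensor is `⊗ e_k + ⊗ y_k`, where `y_k` is `f_k` for `k = i, j` and `e_k`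
otherwise. With functionals dual to the orthonormal vectors, its contracted minor equals `1`. -/
theorem not_pairLocus_subset (hn : ∀ i, 2 ≤ n i) (hB : ∀ i, IsInnerProduct (B i))
    {i j s l : Fin p} (hij : i ≠ j) (hi : i ≠ s) (hj : j ≠ s) :
    ¬ pairLocus B i j ⊆ pairLocus B s l := by
  intro h
  choose e f he hf hef using fun k => exists_orthonormal_pair (hn k) (hB k)
  have hfe (k : Fin p) : complexify (B k) (f k) (e k) = 0 := by rw [complexify_comm (hB k), hef]
  let y (k : Fin p) : Fin (n k) → ℂ := if k = i ∨ k = j then f k else e k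
  have hyi : y i = f i := by simp [y]
  have hyj : y j = f j := by simp [y]
  have hmem : (⨂ₜ[ℂ] k, e k) + (⨂ₜ[ℂ] k, y k) ∈ pairLocus B i j :=
    subset_zariskiClosure _ ⟨e, y, by rw [hyi, hef], by rw [hyj, hef], rfl⟩
  have h0 := contractedMinor_eq_zero_of_mem_pairLocus hB hi hj hij
    (fun k => complexify (B k) (e k)) (complexify (B i) (e i)) (complexify (B i) (f i))
    (complexify (B j) (e j)) (complexify (B j) (f j)) (h hmem)
  have hys : y s = e s := by simp [y, hi.symm, hj.symm]
  have hprod : ∏ k ∈ ((Finset.univ.erase s).erase j).erase i,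
      complexify (B k) (e k) (y k) = 1 := by
    refine Finset.prod_eq_one fun k hk => ?_
    simp only [Finset.mem_erase] at hk
    have : y k = e k := by simp [y, hk.1, hk.2.1]
    rw [this, he]
  rw [contractedMinor_add (hB s) hi hj hij, hprod, hyi, hyj, hys] at h0
  simp [he, hf, hef] at h0

theorem pairLocus_subset_iff (hn : ∀ i, 2 ≤ n i) (hB : ∀ i, IsInnerProduct (B i))
    (s t : {s : Fin p × Fin p // s.1 < s.2})
    (h : pairLocus B s.1.1 s.1.2 ⊆ pairLocus B t.1.1 t.1.2) : s = t := by
  obtain ⟨⟨i, j⟩, hij⟩ := s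
  obtain ⟨⟨k, l⟩, hkl⟩ := t
  dsimp only at hij hkl h
  have hk : i = k ∨ j = k := by
    by_contra! hne
    exact not_pairLocus_subset hn hB hij.ne hne.1 hne.2 h
  have hl : i = l ∨ j = l := by
    by_contra! hne
    rw [pairLocus_eq k, pairSet_comm] at h
    exact not_pairLocus_subset hn hB hij.ne hne.1 hne.2 h
  rcases hk with rfl | rfl <;> rcases hl with rfl | rfl
  · exact absurd hkl (lt_irrefl _)
  · rfl
  · exact absurd hkl hij.asymm
  · exact absurd hkl (lt_irrefl _)

theorem zariskiComponents_DL2 (hp : 2 ≤ p) (hn : ∀ i, 2 ≤ n i)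
    (hB : ∀ i, IsInnerProduct (B i)) :
    zariskiComponents (DL2 B) =
      Set.range fun s : {s : Fin p × Fin p // s.1 < s.2} => pairLocus B s.1.1 s.1.2 :=
  @image_val_irreducibleComponents _ _ (zariskiTopology (TensorSpace n)) _ _
    (fun _ => isClosed_zariskiClosure _) (fun _ => isIrreducible_pairLocus hB _ _)
    (pairLocus_subset_iff hn hB) _ (DL2_eq_iUnion hp hn hB)

/-! ### Weakly orthogonally decomposable tensors of rank at most two. -/

theorem tprod_mem_pairSet (x : ∀ k, Fin (n k) → ℂ) (i j : Fin p) :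
    (⨂ₜ[ℂ] k, x k) ∈ pairSet B i j :=
  ⟨x, 0, by simp, by simp, by rw [tprod_eq_zero (z := 0) i rfl, add_zero]⟩

theorem exists_dual_det_ne_zero {E : Type*} [AddCommGroup E] [Module ℂ E] {u v : E} (hu : u ≠ 0)
    (h : ∀ c : ℂ, v ≠ c • u) :
    ∃ μ μ' : Module.Dual ℂ E, μ u * μ' v - μ v * μ' u ≠ 0 := by
  by_contra! H
  obtain ⟨μ, hμ⟩ : ∃ μ : Module.Dual ℂ E, μ u ≠ 0 := by
    by_contra! h'
    exact hu ((Module.forall_dual_apply_eq_zero_iff ℂ _).1 h')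
  have h1 : μ u • v - μ v • u = 0 :=
    (Module.forall_dual_apply_eq_zero_iff ℂ _).1 fun μ' => by simpa using H μ μ'
  apply h ((μ u)⁻¹ * μ v)
  rw [mul_smul, ← sub_eq_zero.1 h1, smul_smul, inv_mul_cancel₀ hμ, one_smul]

/-- In a decomposition of a weakly orthogonally decomposable tensor into two rank-one tensors, the
vectors in the factor `s` are orthogonal if there are two other factors in which the vectors are
linearly independent. -/
theorem orthogonal_of_isWeaklyOdeco (hB : ∀ i, IsInnerProduct (B i)) {s a b : Fin p} (hsa : a ≠ s)
    (hsb : b ≠ s) (hab : a ≠ b) {u v : ∀ k, Fin (n k) → ℂ} (hu : ∀ k, u k ≠ 0)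
    (hv : ∀ k, v k ≠ 0) (ha : ∀ c : ℂ, v a ≠ c • u a) (hb : ∀ c : ℂ, v b ≠ c • u b)
    (hT : IsWeaklyOdeco B ((⨂ₜ[ℂ] k, u k) + ⨂ₜ[ℂ] k, v k)) :
    complexify (B s) (u s) (v s) = 0 := by
  obtain ⟨m, x, -, hx, hTx⟩ := hT
  obtain ⟨μ, μ', hμ⟩ := exists_dual_det_ne_zero (hu a) ha
  obtain ⟨ν, ν', hν⟩ := exists_dual_det_ne_zero (hu b) hb
  have hψ (k : Fin p) : ∃ ψ : Module.Dual ℂ (Fin (n k) → ℂ), ψ (u k) ≠ 0 ∧ ψ (v k) ≠ 0 := by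
    obtain ⟨ψ, hψ⟩ := Module.exists_dual_forall_apply_ne_zero (K := ℂ) ![u k, v k] (by
      intro i
      fin_cases i
      exacts [hu k, hv k])
    exact ⟨ψ, hψ 0, hψ 1⟩
  choose ψ hψu hψv using hψ
  have h1 := contractedMinor_add (ψ := ψ) (μ := μ) (μ' := μ') (ν := ν) (ν' := ν') (hB s)
    hsa hsb hab u v
  rw [hTx, contractedMinor_sum_eq_zero hsa hsb hab fun k l hkl => hx k l hkl s] at h1
  refine (mul_eq_zero.1 h1.symm).resolve_left (mul_ne_zero (mul_ne_zero hμ hν) (mul_ne_zero ?_ ?_))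
  · exact Finset.prod_ne_zero_iff.2 fun k _ => hψu k
  · exact Finset.prod_ne_zero_iff.2 fun k _ => hψv k

/-- A polynomial in the entries of the Gram matrices of two pairs of vectors `a₁, a₂` and
`c₁, c₂` whose nonvanishing ensures that `a₁ ⊗ c₁ + a₂ ⊗ c₂` can be rewritten with orthogonal
pairs. -/
def gramResolvent (α β γ α' β' γ' : ℂ) : ℂ :=
  (α * α' - γ * γ') * ((α * α' - γ * γ') * (α * α' - γ * γ') +
    4 * ((β * α' + γ * β') * (α * β' + β * γ')))

theorem exists_mul_sq_sub_add_one_eq_zero (q : ℂ) : ∃ k : ℂ, q * k ^ 2 - k + 1 = 0 := by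
  by_cases hq : q = 0
  · exact ⟨1, by simp [hq]⟩
  · obtain ⟨z, hz⟩ := IsAlgClosed.exists_pow_nat_eq (1 - 4 * q) (n := 2) two_pos
    refine ⟨(1 + z) / (2 * q), ?_⟩
    field_simp
    linear_combination hz

/-- The new `x` vectors come from a change of basis, and the `y` vectors from its inverse transpose,
so the sum is preserved. Since `1 + P * Q * k ^ 2 = k`, the quadratic orthogonality conditions
become `k` times the linear equations `h3` and `h4` in `P` and `Q`, which Cramer's rule solves with
determinant `Δ`. The change of basis has determinant `1 - P * Q * k ^ 2 = 2 - k`. -/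
theorem exists_orthogonal_redecomposition {E F W : Type*} [AddCommGroup E] [Module ℂ E]
    [AddCommGroup F] [Module ℂ F] [AddCommGroup W] [Module ℂ W] (b : LinearMap.BilinForm ℂ E)
    (b' : LinearMap.BilinForm ℂ F) (hb : ∀ x y, b x y = b y x) (hb' : ∀ x y, b' x y = b' y x)
    (Φ : E →ₗ[ℂ] F →ₗ[ℂ] W) (a₁ a₂ : E) (c₁ c₂ : F)
    (h : gramResolvent (b a₁ a₁) (b a₁ a₂) (b a₂ a₂) (b' c₁ c₁) (b' c₁ c₂) (b' c₂ c₂) ≠ 0) :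
    ∃ x₁ x₂ y₁ y₂, b x₁ x₂ = 0 ∧ b' y₁ y₂ = 0 ∧
      Φ x₁ y₁ + Φ x₂ y₂ = Φ a₁ c₁ + Φ a₂ c₂ := by
  have hba := hb a₂ a₁
  have hbc := hb' c₂ c₁
  generalize hα : b a₁ a₁ = α at h
  generalize hβ : b a₁ a₂ = β at h hba
  generalize hγ : b a₂ a₂ = γ at h
  generalize hα' : b' c₁ c₁ = α' at h
  generalize hβ' : b' c₁ c₂ = β' at h hbc
  generalize hγ' : b' c₂ c₂ = γ' at h
  have hΔ := left_ne_zero_of_mul h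
  have h2 := right_ne_zero_of_mul h
  obtain ⟨Δ, hΔe⟩ : ∃ Δ, Δ = α * α' - γ * γ' := ⟨_, rfl⟩
  rw [← hΔe] at hΔ h2
  obtain ⟨P, hP⟩ : ∃ P, P = -(β * α' + γ * β') / Δ := ⟨_, rfl⟩
  obtain ⟨Q, hQ⟩ : ∃ Q, Q = (α * β' + β * γ') / Δ := ⟨_, rfl⟩
  have hPΔ : P * Δ = -(β * α' + γ * β') := by rw [hP, div_mul_cancel₀ _ hΔ]
  have hQΔ : Q * Δ = α * β' + β * γ' := by rw [hQ, div_mul_cancel₀ _ hΔ]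
  have h3 : P * α + Q * γ + β = 0 := by
    refine (mul_eq_zero.1 ?_).resolve_right hΔ
    linear_combination α * hPΔ + γ * hQΔ + β * hΔe
  have h4 : P * γ' + Q * α' - β' = 0 := by
    refine (mul_eq_zero.1 ?_).resolve_right hΔ
    linear_combination γ' * hPΔ + α' * hQΔ - β' * hΔe
  obtain ⟨k, hk⟩ := exists_mul_sq_sub_add_one_eq_zero (P * Q)
  -- If `k = 2`, then `4 * P * Q = 1`; after multiplication by `Δ ^ 2` this is the vanishing of the
  -- second factor of `gramResolvent`.
  have hk2 : 2 - k ≠ 0 := by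
    intro hk2
    obtain rfl : k = 2 := by linear_combination -hk2
    apply h2
    linear_combination Δ ^ 2 * (-hk) + 4 * (Q * Δ) * hPΔ - 4 * (β * α' + γ * β') * hQΔ
  refine ⟨a₁ + (Q * k) • a₂, (P * k) • a₁ + a₂, (2 - k)⁻¹ • (c₁ - (P * k) • c₂),
    (2 - k)⁻¹ • (c₂ - (Q * k) • c₁), ?_, ?_, ?_⟩
  · simp only [map_add, map_smul, LinearMap.add_apply, LinearMap.smul_apply, smul_eq_mul, hα, hβ,
      hγ, hba]
    linear_combination k * h3 + β * hk
  · simp only [map_sub, map_smul, LinearMap.sub_apply, LinearMap.smul_apply, smul_eq_mul, hα',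
      hβ', hγ', hbc]
    linear_combination (2 - k)⁻¹ ^ 2 * (-k * h4 + β' * hk)
  · have hinv : (2 - k)⁻¹ * (1 - P * k * (Q * k)) = 1 := by
      rw [show 1 - P * k * (Q * k) = 2 - k by linear_combination -hk, inv_mul_cancel₀ hk2]
    rw [← one_smul ℂ (Φ a₁ c₁ + Φ a₂ c₂), ← hinv]
    simp only [map_add, map_sub, map_smul, LinearMap.add_apply, LinearMap.smul_apply]
    module

/-- The bilinear map that inserts vectors in the factors `a` and `b` of a rank-one tensor. -/
def insertPair (u : ∀ k, Fin (n k) → ℂ) {a b : Fin p} (hab : a ≠ b) :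
    (Fin (n a) → ℂ) →ₗ[ℂ] (Fin (n b) → ℂ) →ₗ[ℂ] TensorSpace n :=
  LinearMap.mk₂ ℂ (fun x y => ⨂ₜ[ℂ] k, update (update u a x) b y k)
    (fun x x' y => by simp only [update_comm hab, MultilinearMap.map_update_add])
    (fun c x y => by simp only [update_comm hab, MultilinearMap.map_update_smul])
    (fun x y y' => by simp only [MultilinearMap.map_update_add])
    (fun c x y => by simp only [MultilinearMap.map_update_smul])

theorem insertPair_apply (u : ∀ k, Fin (n k) → ℂ) {a b : Fin p} (hab : a ≠ b)
    (x : Fin (n a) → ℂ) (y : Fin (n b) → ℂ) :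
    insertPair u hab x y = ⨂ₜ[ℂ] k, update (update u a x) b y k := rfl

/-- Scalars can be moved into the factor `a`. -/
theorem exists_tprod_eq_update {w v : ∀ k, Fin (n k) → ℂ} (a : Fin p)
    (h : ∀ s, s ≠ a → ∃ c : ℂ, v s = c • w s) :
    ∃ x, (⨂ₜ[ℂ] k, v k) = ⨂ₜ[ℂ] k, update w a x k := by
  have h' (s : Fin p) : ∃ c : ℂ, v s = c • update w a (v a) s := by
    by_cases hs : s = a
    · subst hs
      exact ⟨1, by simp⟩
    · obtain ⟨c, hc⟩ := h s hs
      exact ⟨c, by rw [hc, update_of_ne hs]⟩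
  choose c hc using h'
  refine ⟨(∏ s, c s) • v a, ?_⟩
  rw [MultilinearMap.map_update_smul, ← MultilinearMap.map_smul_univ]
  congr 1
  exact funext hc

/-- A sum of two rank-one tensors that are proportional in all factors except `a` and `b` is a
limit of sums that are orthogonal in `a` and `b` and agree in the other factors. -/
theorem add_mem_zariskiClosure_orthogonal (hn : ∀ i, 2 ≤ n i) (hB : ∀ i, IsInnerProduct (B i))
    {a b : Fin p} (hab : a ≠ b) {u v : ∀ k, Fin (n k) → ℂ}
    (h : ∀ s, s ≠ a → s ≠ b → ∃ c : ℂ, v s = c • u s) :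
    (⨂ₜ[ℂ] k, u k) + (⨂ₜ[ℂ] k, v k) ∈ zariskiClosure {T : TensorSpace n |
      ∃ x y : ∀ k, Fin (n k) → ℂ, complexify (B a) (x a) (y a) = 0 ∧
        complexify (B b) (x b) (y b) = 0 ∧
        (∀ s, s ≠ a → s ≠ b → x s = u s ∧ y s = u s) ∧
        T = (⨂ₜ[ℂ] k, x k) + ⨂ₜ[ℂ] k, y k} := by
  obtain ⟨z, hz⟩ := exists_tprod_eq_update (w := update u b (v b)) (v := v) a fun s hs => by
    by_cases hsb : s = b
    · subst hsb
      exact ⟨1, by simp⟩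
    · rw [update_of_ne hsb]
      exact h s hs hsb
  have hv : (⨂ₜ[ℂ] k, v k) = insertPair u hab z (v b) := by
    rw [hz, insertPair_apply, update_comm hab]
  have hu : (⨂ₜ[ℂ] k, u k) = insertPair u hab (u a) (u b) := by
    rw [insertPair_apply, update_eq_self, update_eq_self]
  rw [hu, hv]
  obtain ⟨e, f, he, hf, hef⟩ := exists_orthonormal_pair (hn a) (hB a)
  obtain ⟨e', f', he', hf', hef'⟩ := exists_orthonormal_pair (hn b) (hB b)
  let a₁ (t : ℂ) := AffineMap.lineMap (k := ℂ) e (u a) t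
  let a₂ (t : ℂ) := AffineMap.lineMap (k := ℂ) f z t
  -- The factor `2` makes the resolvent nonzero at `t = 0`: the determinant there is `1 * 4 - 1 * 1
  -- = 3`, whereas with `e'` alone it would be `0`.
  let c₁ (t : ℂ) := AffineMap.lineMap (k := ℂ) ((2 : ℂ) • e') (u b) t
  let c₂ (t : ℂ) := AffineMap.lineMap (k := ℂ) f' (v b) t
  have ha₁ : IsPolyCurve a₁ := isPolyCurve_line _ _
  have ha₂ : IsPolyCurve a₂ := isPolyCurve_line _ _
  have hc₁ : IsPolyCurve c₁ := isPolyCurve_line _ _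
  have hc₂ : IsPolyCurve c₂ := isPolyCurve_line _ _
  have hins {x : ℂ → Fin (n a) → ℂ} {y : ℂ → Fin (n b) → ℂ} (hx : IsPolyCurve x)
      (hy : IsPolyCurve y) : IsPolyCurve fun t => insertPair u hab (x t) (y t) := by
    refine IsPolyCurve.tprod (c := fun k t => update (update u a (x t)) b (y t) k) fun k => ?_
    by_cases hkb : k = b
    · subst hkb
      simpa using hy
    · by_cases hka : k = a
      · subst hka
        simpa [hkb] using hx
      · simpa [hkb, hka] using isPolyCurve_const (u k)
  let α (t : ℂ) := complexify (B a) (a₁ t) (a₁ t)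
  let β (t : ℂ) := complexify (B a) (a₁ t) (a₂ t)
  let γ (t : ℂ) := complexify (B a) (a₂ t) (a₂ t)
  let α' (t : ℂ) := complexify (B b) (c₁ t) (c₁ t)
  let β' (t : ℂ) := complexify (B b) (c₁ t) (c₂ t)
  let γ' (t : ℂ) := complexify (B b) (c₂ t) (c₂ t)
  have hα : α ∈ polyLine := complexify_curve_mem_polyLine ha₁ ha₁
  have hβ : β ∈ polyLine := complexify_curve_mem_polyLine ha₁ ha₂
  have hγ : γ ∈ polyLine := complexify_curve_mem_polyLine ha₂ ha₂
  have hα' : α' ∈ polyLine := complexify_curve_mem_polyLine hc₁ hc₁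
  have hβ' : β' ∈ polyLine := complexify_curve_mem_polyLine hc₁ hc₂
  have hγ' : γ' ∈ polyLine := complexify_curve_mem_polyLine hc₂ hc₂
  have hΔ := sub_mem (mul_mem hα hα') (mul_mem hγ hγ')
  have hres : (fun t => gramResolvent (α t) (β t) (γ t) (α' t) (β' t) (γ' t)) ∈ polyLine :=
    mul_mem hΔ (add_mem (mul_mem hΔ hΔ) (mul_mem (const_mem_polyLine 4)
      (mul_mem (add_mem (mul_mem hβ hα') (mul_mem hγ hβ'))
        (add_mem (mul_mem hα hβ') (mul_mem hβ hγ')))))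
  have hcurve := ((hins ha₁ hc₁).add (hins ha₂ hc₂)).mem_zariskiClosure hres (t₀ := 0)
    (S := {T : TensorSpace n | ∃ x y : ∀ k, Fin (n k) → ℂ, complexify (B a) (x a) (y a) = 0 ∧
      complexify (B b) (x b) (y b) = 0 ∧ (∀ s, s ≠ a → s ≠ b → x s = u s ∧ y s = u s) ∧
      T = (⨂ₜ[ℂ] k, x k) + ⨂ₜ[ℂ] k, y k}) ?_ (fun t ht => ?_) 1
  · simpa [a₁, a₂, c₁, c₂] using hcurve
  · simp [gramResolvent, α, β, γ, α', β', γ', a₁, a₂, c₁, c₂, he, hf, hef, he', hf', hef']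
    norm_num
  · obtain ⟨x₁, x₂, y₁, y₂, hx, hy, hΦ⟩ := exists_orthogonal_redecomposition _ _
      (complexify_comm (hB a)) (complexify_comm (hB b)) (insertPair u hab) _ _ _ _ ht
    refine ⟨update (update u a x₁) b y₁, update (update u a x₂) b y₂, by simpa [hab] using hx,
      by simpa using hy, fun s hsa hsb => by simp [hsa, hsb], hΦ.symm⟩

theorem mem_pairLocus_of_isWeaklyOdeco (hn : ∀ i, 2 ≤ n i) (hB : ∀ i, IsInnerProduct (B i))
    {T : TensorSpace n} (h2 : RankLE 2 T) (hT : IsWeaklyOdeco B T) (i j : Fin p) :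
    T ∈ pairLocus B i j := by
  obtain ⟨w, hw, rfl⟩ := h2
  obtain ⟨u, hu⟩ := hw 0
  obtain ⟨v, hv⟩ := hw 1
  rw [Fin.sum_univ_two, hu, hv] at hT ⊢
  by_cases hu0 : ∃ k, u k = 0
  · obtain ⟨k, hk⟩ := hu0
    rw [tprod_eq_zero k hk, zero_add]
    exact subset_zariskiClosure _ (tprod_mem_pairSet v i j)
  by_cases hv0 : ∃ k, v k = 0
  · obtain ⟨k, hk⟩ := hv0
    rw [tprod_eq_zero k hk, add_zero]
    exact subset_zariskiClosure _ (tprod_mem_pairSet u i j)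
  push Not at hu0 hv0
  by_cases hK : ∃ a b, a ≠ b ∧ (∀ c : ℂ, v a ≠ c • u a) ∧ ∀ c : ℂ, v b ≠ c • u b
  · obtain ⟨a, b, hab, ha, hb⟩ := hK
    have hs (s : Fin p) (hsa : s ≠ a) (hsb : s ≠ b) : complexify (B s) (u s) (v s) = 0 :=
      orthogonal_of_isWeaklyOdeco hB hsa.symm hsb.symm hab hu0 hv0 ha hb hT
    by_cases hc : ∃ c, c ≠ a ∧ c ≠ b ∧ ∀ r : ℂ, v c ≠ r • u c
    · obtain ⟨c, hca, hcb, hc⟩ := hc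
      have hall (s : Fin p) : complexify (B s) (u s) (v s) = 0 := by
        by_cases hsa : s = a
        · subst hsa
          exact orthogonal_of_isWeaklyOdeco hB hab.symm hca hcb.symm hu0 hv0 hb hc hT
        by_cases hsb : s = b
        · subst hsb
          exact orthogonal_of_isWeaklyOdeco hB hab hcb hca.symm hu0 hv0 ha hc hT
        exact hs s hsa hsb
      exact subset_zariskiClosure _ ⟨u, v, hall i, hall j, rfl⟩
    · push Not at hc
      refine zariskiClosure_mono ?_ (add_mem_zariskiClosure_orthogonal hn hB hab hc)
      rintro _ ⟨x, y, hxa, hxb, hxy, rfl⟩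
      have hall (s : Fin p) : complexify (B s) (x s) (y s) = 0 := by
        by_cases hsa : s = a
        · subst hsa; exact hxa
        by_cases hsb : s = b
        · subst hsb; exact hxb
        obtain ⟨c, hc⟩ := hc s hsa hsb
        -- Since `v s` is a nonzero multiple of `u s`, orthogonality makes `u s` isotropic. The
        -- approximating sums, which have `u s` in both terms, are thus orthogonal in this factor as
        -- well.
        have h0 := hs s hsa hsb
        rw [hc, map_smul, smul_eq_mul] at h0
        rw [(hxy s hsa hsb).1, (hxy s hsa hsb).2]
        refine (mul_eq_zero.1 h0).resolve_left ?_
        rintro rfl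
        exact hv0 s (by rw [hc, zero_smul])
      exact ⟨x, y, hall i, hall j, rfl⟩
  · push Not at hK
    -- The two terms are proportional in all factors except possibly `a`, so they merge into a
    -- single rank-one tensor.
    obtain ⟨a, ha⟩ : ∃ a, ∀ s, s ≠ a → ∃ c : ℂ, v s = c • u s := by
      by_cases h : ∃ a, ∀ c : ℂ, v a ≠ c • u a
      · obtain ⟨a, ha⟩ := h
        exact ⟨a, fun s hs => hK a s hs.symm ha⟩
      · push Not at h
        exact ⟨i, fun s _ => h s⟩
    obtain ⟨x, hx⟩ := exists_tprod_eq_update a ha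
    have : (⨂ₜ[ℂ] k, u k) + (⨂ₜ[ℂ] k, v k) = ⨂ₜ[ℂ] k, update u a (u a + x) k := by
      rw [hx, MultilinearMap.map_update_add, update_eq_self]
    rw [this]
    exact subset_zariskiClosure _ (tprod_mem_pairSet _ i j)

end TensorDL

end

theorem mainTheorem9 (p : ℕ) (hp : 2 ≤ p) (n : Fin p → ℕ) (hn : ∀ i, 2 ≤ n i)
    (B : ∀ i, LinearMap.BilinForm ℝ (Fin (n i) → ℝ)) (hB : ∀ i, TensorDL.IsInnerProduct (B i)) :
    (TensorDL.zariskiComponents (TensorDL.DL2 B)).encard = p.choose 2 ∧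
    Set.BijOn (fun s : Fin p × Fin p => TensorDL.pairLocus B s.1 s.2)
      {s | s.1 < s.2} (TensorDL.zariskiComponents (TensorDL.DL2 B)) ∧
    ∀ T : TensorDL.TensorSpace n, TensorDL.RankLE 2 T → TensorDL.IsWeaklyOdeco B T →
      ∀ C ∈ TensorDL.zariskiComponents (TensorDL.DL2 B), T ∈ C := by
  have hcomp := TensorDL.zariskiComponents_DL2 hp hn hB
  have hbij : Set.BijOn (fun s : Fin p × Fin p => TensorDL.pairLocus B s.1 s.2)
      {s | s.1 < s.2} (TensorDL.zariskiComponents (TensorDL.DL2 B)) := by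
    rw [hcomp]
    refine ⟨fun s hs => ⟨⟨s, hs⟩, rfl⟩, fun s hs t ht hst => ?_, ?_⟩
    · exact congrArg Subtype.val
        (TensorDL.pairLocus_subset_iff hn hB ⟨s, hs⟩ ⟨t, ht⟩ hst.subset)
    · rintro _ ⟨s, rfl⟩
      exact ⟨s.1, s.2, rfl⟩
  refine ⟨?_, hbij, ?_⟩
  · rw [← hbij.image_eq, hbij.injOn.encard_image]
    have h : {s : Fin p × Fin p | s.1 < s.2} =
        ((Finset.univ.filter fun s : Fin p × Fin p => s.1 < s.2 : Finset _) : Set _) := by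
      simp
    rw [h, Set.encard_coe_eq_coe_finsetCard, Fintype.card_product_filter_lt, Fintype.card_fin]
  · intro T h2 hT C hC
    rw [hcomp] at hC
    obtain ⟨s, rfl⟩ := hC
    exact TensorDL.mem_pairLocus_of_isWeaklyOdeco hn hB h2 hT _ _
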